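/- Theorem. Let a channel state evolve as a two-state (Good/Bad) Gilbert–Elliott Markov chain with transition probabilities $\alpha\in[0,1]$ from Good to Bad and $\beta\in[0,1]$ from Bad to Good, and let $(p,q)=\left(\frac{\beta}{\alpha+\beta},\frac{\alpha}{\alpha+\beta}\right)$ be its stationary distribution, where $p,q\neq 0$. Let $F_g$ and $F_b$ be the distribution functions of the Gaussian laws with means $\mu_g,\mu_b\in\mathbb{R}$ and standard deviations $\sigma_g,\sigma_b>0$, where either $\sigma_g>\sigma_b$, or $\sigma_g=\sigma_b$ and $\mu_g>\mu_b$. Let $C_1,C_2,\dots$ (the users' capacities in a time slot) be independent real random variables on a probability space, each with the stationary marginal distribution function $F=pF_g+qF_b$, and let $M_K=\max\{C_1,\dots,C_K\}$. For $K\ge 2$ put $$a_K=\frac{\sqrt{2\log K}}{\sigma_g},\qquad b_K=\sigma_g\left(\sqrt{2\log K}-\frac{\log\log K+\log\frac{4\pi}{p^2}}{2\sqrt{2\log K}}\right)+\mu_g .$$ Then the normalized maximum converges in distribution to the Gumbel law: for every $x\in\mathbb{R}$, $$P\left(a_K(M_K-b_K)\le x\right)\longrightarrow e^{-e^{-x}}\qquad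 (K\to\infty).$$ Moreover, every $M_K$ is integrable and the expected capacity of the scheduled user satisfies $$E[M_K]=b_K+\frac{\gamma}{a_K}+o\left(\frac{1}{a_K}\right)\qquad (K\to\infty),$$ where $\gamma$ is the Euler–Mascheroni constant. -/

import Mathlib

open MeasureTheory ProbabilityTheory Filter Topology Asymptotics

namespace GilbertElliott

/-- The two states of the channel of a user. -/
inductive ChannelState where
  | good : ChannelState
  | bad : ChannelState

/-- One-step transition probabilities of the channel state: good to bad with probability `α`,
bad to good with probability `β`. -/
def transition (α β : ℝ) : ChannelState → ChannelState → ℝ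
  | .good, .good => 1 - α
  | .good, .bad => α
  | .bad, .good => β
  | .bad, .bad => 1 - β

/-- The stationary distribution `(β / (α + β), α / (α + β))` of the channel state. -/
noncomputable def stationary (α β : ℝ) : ChannelState → ℝ
  | .good => β / (α + β)
  | .bad => α / (α + β)

/-- `stationary α β` is the one and only probability vector that is invariant under
`transition α β`. -/
theorem stationary_spec {α β : ℝ} (h : α + β ≠ 0) (w : ChannelState → ℝ) :
    (w .good + w .bad = 1 ∧
      ∀ t, w .good * transition α β .good t + w .bad * transition α β .bad t = w t) ↔
      w = stationary α β := by
  constructor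
  · rintro ⟨h1, h2⟩
    have h3 := h2 .good
    simp only [transition] at h3
    funext t
    cases t
    · rw [stationary, eq_div_iff h]
      linear_combination (-1 : ℝ) * h3 + β * h1
    · rw [stationary, eq_div_iff h]
      linear_combination h3 + α * h1
  · rintro rfl
    refine ⟨?_, fun t => ?_⟩
    · simp only [stationary]
      field_simp
      ring
    · cases t <;> simp only [stationary, transition] <;> field_simp <;> ring

/-- The distribution function of the Gaussian law with mean `m` and standard deviation `s`. -/
noncomputable def gaussianCDF (m s : ℝ) (x : ℝ) : ℝ :=
  cdf (gaussianReal m ⟨s ^ 2, sq_nonneg s⟩) x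

/-- The stationary marginal distribution function `F = p F_g + q F_b` of the capacity of a user. -/
noncomputable def capacityCDF (α β μg μb σg σb : ℝ) (x : ℝ) : ℝ :=
  stationary α β .good * gaussianCDF μg σg x + stationary α β .bad * gaussianCDF μb σb x

/-- The largest of the first `K` capacities (meant for `1 ≤ K`). -/
noncomputable def maxCapacity {Ω : Type*} (C : ℕ → Ω → ℝ) (K : ℕ) (ω : Ω) : ℝ :=
  ⨆ i : Fin K, C i ω

/-- The normalizing constant `a_K`. -/
noncomputable def scaleConst (σg : ℝ) (K : ℕ) : ℝ :=
  √(2 * Real.log K) / σg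

/-- The normalizing constant `b_K`, where `p` is the stationary probability of the good state. -/
noncomputable def locConst (p μg σg : ℝ) (K : ℕ) : ℝ :=
  σg * (√(2 * Real.log K)
    - (Real.log (Real.log K) + Real.log (4 * Real.pi / p ^ 2)) / (2 * √(2 * Real.log K))) + μg

end GilbertElliott

/-!
Above a high level the bad state is negligible, so the capacity tail is asymptotic to `p` times the
standard Gaussian tail `Q` in the units of the good state. Mills' ratio `z * Q z ∼ φ z` then gives
`K * P (C > b_K + t / a_K) → exp (-t)`, hence `P (M_K ≤ b_K + t / a_K) = F ^ K → exp (-exp (-t))`.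

For the expectation, write `E[X] = ∫₀^∞ (1 - P (X ≤ t)) dt - ∫₀^∞ P (X ≤ -t) dt` for the normalized
maximum `X`. The inequality `Q (z + h) ≤ Q z * exp (-z * h)` dominates both integrands by multiples
of `exp (-t / 2)`, except on the remote lower tail `t > log K / 2`, which is small because all of
`K` variables would have to be unusually small. The limit is the mean of the Gumbel law, the law of
`-log E` for a standard exponential variable `E`; this mean is minus the derivative of `Γ` at `1`,
hence `γ`.
-/

namespace GilbertElliott

section TailIntegrals

theorem setOf_le_neg_eq_setOf_le_max {Ω : Type*} (X : Ω → ℝ) {t : ℝ} (ht : 0 < t) :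
    {ω | X ω ≤ -t} = {ω | t ≤ max (-X ω) 0} := by
  ext ω
  simp only [Set.mem_ofPred_eq, le_max_iff, ht.not_ge, or_false, le_neg]

variable {Ω : Type*} [MeasurableSpace Ω] {P : Measure Ω}

theorem integrableOn_measureReal_le_neg [IsFiniteMeasure P] {X : Ω → ℝ} (hX : Integrable X P) :
    IntegrableOn (fun t : ℝ => P.real {ω | X ω ≤ -t}) (Set.Ioi 0) := by
  have hneg : Integrable (fun ω => max (-X ω) 0) P := hX.neg.pos_part
  have hanti : Antitone fun t : ℝ => P.real {ω | X ω ≤ -t} := fun s t hst =>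
    measureReal_mono fun ω (hω : X ω ≤ -t) => hω.trans (neg_le_neg hst)
  refine ⟨hanti.measurable.aestronglyMeasurable, ?_⟩
  rw [hasFiniteIntegral_iff_ofReal (Eventually.of_forall fun t => measureReal_nonneg)]
  calc ∫⁻ t in Set.Ioi (0 : ℝ), ENNReal.ofReal (P.real {ω | X ω ≤ -t})
      = ∫⁻ t in Set.Ioi (0 : ℝ), P {ω | t ≤ max (-X ω) 0} :=
        setLIntegral_congr_fun measurableSet_Ioi fun t ht => by
          rw [← setOf_le_neg_eq_setOf_le_max X ht, ofReal_measureReal]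
    _ = ∫⁻ ω, ENNReal.ofReal (max (-X ω) 0) ∂P :=
        (lintegral_eq_lintegral_meas_le P (Eventually.of_forall fun ω => le_max_right _ _)
          hneg.aemeasurable).symm
    _ < ⊤ := hneg.lintegral_lt_top

theorem integral_measureReal_le_neg {X : Ω → ℝ} (hX : Integrable X P) :
    ∫ t in Set.Ioi (0 : ℝ), P.real {ω | X ω ≤ -t} = ∫ ω, max (-X ω) 0 ∂P := by
  have hneg : Integrable (fun ω => max (-X ω) 0) P := hX.neg.pos_part
  rw [hneg.integral_eq_integral_meas_le (Eventually.of_forall fun ω => le_max_right _ _)]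
  exact setIntegral_congr_fun measurableSet_Ioi fun t ht => by
    simp only [setOf_le_neg_eq_setOf_le_max X ht]

theorem integral_measureReal_le_neg_le_integral_abs {X : Ω → ℝ} (hX : Integrable X P) :
    ∫ t in Set.Ioi (0 : ℝ), P.real {ω | X ω ≤ -t} ≤ ∫ ω, |X ω| ∂P := by
  rw [integral_measureReal_le_neg hX]
  exact integral_mono hX.neg.pos_part hX.abs fun ω => max_le (neg_le_abs _) (abs_nonneg _)

theorem integral_eq_integral_one_sub_cdf_sub_integral_cdf [IsProbabilityMeasure P] {X : Ω → ℝ}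
    (hX : Integrable X P) :
    ∫ ω, X ω ∂P = (∫ t in Set.Ioi (0 : ℝ), (1 - P.real {ω | X ω ≤ t}))
      - ∫ t in Set.Ioi (0 : ℝ), P.real {ω | X ω ≤ -t} := by
  have hpos : Integrable (fun ω => max (X ω) 0) P := hX.pos_part
  have hupper : ∫ t in Set.Ioi (0 : ℝ), (1 - P.real {ω | X ω ≤ t}) = ∫ ω, max (X ω) 0 ∂P := by
    rw [hpos.integral_eq_integral_meas_lt (Eventually.of_forall fun ω => le_max_right _ _)]
    refine setIntegral_congr_fun measurableSet_Ioi fun t (ht : 0 < t) => ?_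
    have hnull : NullMeasurableSet {ω | X ω ≤ t} P :=
      nullMeasurableSet_le hX.aemeasurable aemeasurable_const
    have hcompl : {ω | t < max (X ω) 0} = {ω | X ω ≤ t}ᶜ := by
      ext ω
      simp only [Set.mem_ofPred_eq, Set.mem_compl_iff, lt_max_iff, ht.not_gt, or_false, not_le]
    simp only [hcompl, probReal_compl_eq_one_sub₀ hnull]
  rw [hupper, integral_measureReal_le_neg hX,
    integral_eq_integral_pos_part_sub_integral_neg_part hX]
  simp only [Real.coe_toNNReal']

end TailIntegrals

section DominatedConvergence

theorem tendsto_setIntegral_Ioi_of_dominated_of_remainder {ι : Type*} {l : Filter ι}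
    [l.IsCountablyGenerated] {f : ι → ℝ → ℝ} {g bound : ℝ → ℝ} {a : ℝ} {T : ι → ℝ}
    (hT : Tendsto T l atTop) (hf : ∀ i, IntegrableOn (f i) (Set.Ioi a))
    (hbound : IntegrableOn bound (Set.Ioi a))
    (hdom : ∀ᶠ i in l, ∀ t ∈ Set.Ioc a (T i), ‖f i t‖ ≤ bound t)
    (hlim : ∀ t ∈ Set.Ioi a, Tendsto (fun i => f i t) l (𝓝 (g t)))
    (hrem : Tendsto (fun i => ∫ t in Set.Ioi (T i), f i t) l (𝓝 0)) :
    Tendsto (fun i => ∫ t in Set.Ioi a, f i t) l (𝓝 (∫ t in Set.Ioi a, g t)) := by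
  have htrunc : Tendsto (fun i => ∫ t in Set.Ioi a, (Set.Iic (T i)).indicator (f i) t) l
      (𝓝 (∫ t in Set.Ioi a, g t)) := by
    refine tendsto_integral_filter_of_dominated_convergence (fun t => |bound t|)
      (Eventually.of_forall fun i => (hf i).aestronglyMeasurable.indicator measurableSet_Iic)
      ?_ hbound.abs ?_
    · filter_upwards [hdom] with i hi
      refine (ae_restrict_iff' measurableSet_Ioi).mpr (Eventually.of_forall fun t ht => ?_)
      by_cases htT : t ∈ Set.Iic (T i)
      · rw [Set.indicator_of_mem htT]
        exact (hi t ⟨ht, htT⟩).trans (le_abs_self _)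
      · rw [Set.indicator_of_notMem htT, norm_zero]
        exact abs_nonneg _
    · refine (ae_restrict_iff' measurableSet_Ioi).mpr (Eventually.of_forall fun t ht => ?_)
      refine (hlim t ht).congr' ?_
      filter_upwards [hT.eventually_ge_atTop t] with i hi
      rw [Set.indicator_of_mem (Set.mem_Iic.mpr hi)]
  rw [← add_zero (∫ t in Set.Ioi a, g t)]
  refine (htrunc.add hrem).congr' ?_
  filter_upwards [hT.eventually_ge_atTop a] with i hi
  rw [setIntegral_indicator measurableSet_Iic, Set.Ioi_inter_Iic, ← setIntegral_union
    (Set.Ioc_disjoint_Ioi le_rfl) measurableSet_Ioi ((hf i).mono_set Set.Ioc_subset_Ioi_self)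
    ((hf i).mono_set (Set.Ioi_subset_Ioi hi)), Set.Ioc_union_Ioi_eq_Ioi hi]

theorem tendsto_integral_of_tendsto_cdf {ι : Type*} {l : Filter ι} [l.IsCountablyGenerated]
    {Ω : Type*} [MeasurableSpace Ω] {P : Measure Ω} [IsProbabilityMeasure P] {X : ι → Ω → ℝ}
    (hX : ∀ i, Integrable (X i) P) {G : ℝ → ℝ}
    (hlim : ∀ x, Tendsto (fun i => P.real {ω | X i ω ≤ x}) l (𝓝 (G x)))
    {upper lower : ℝ → ℝ} {T : ι → ℝ} (hT : Tendsto T l atTop)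
    (hupper : IntegrableOn upper (Set.Ioi 0)) (hlower : IntegrableOn lower (Set.Ioi 0))
    (hup : ∀ᶠ i in l, ∀ t, 0 < t → 1 - P.real {ω | X i ω ≤ t} ≤ upper t)
    (hlow : ∀ᶠ i in l, ∀ t ∈ Set.Ioc 0 (T i), P.real {ω | X i ω ≤ -t} ≤ lower t)
    (hrem : Tendsto (fun i => ∫ t in Set.Ioi (T i), P.real {ω | X i ω ≤ -t}) l (𝓝 0)) :
    Tendsto (fun i => ∫ ω, X i ω ∂P) l
      (𝓝 ((∫ t in Set.Ioi (0 : ℝ), (1 - G t)) - ∫ t in Set.Ioi (0 : ℝ), G (-t))) := by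
  simp only [fun i => integral_eq_integral_one_sub_cdf_sub_integral_cdf (hX i)]
  refine Tendsto.sub ?_ ?_
  · have hmono : ∀ i, Monotone fun t => P.real {ω | X i ω ≤ t} := fun i s t hst =>
      measureReal_mono fun ω (hω : X i ω ≤ s) => hω.trans hst
    refine tendsto_integral_filter_of_dominated_convergence upper
      (Eventually.of_forall fun i =>
        ((hmono i).measurable.const_sub 1).aestronglyMeasurable) ?_ hupper
      (Eventually.of_forall fun t => (hlim t).const_sub 1)
    filter_upwards [hup] with i hi
    refine (ae_restrict_iff' measurableSet_Ioi).mpr (Eventually.of_forall fun t ht => ?_)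
    rw [Real.norm_of_nonneg (sub_nonneg.mpr measureReal_le_one)]
    exact hi t ht
  · refine tendsto_setIntegral_Ioi_of_dominated_of_remainder hT
      (fun i => integrableOn_measureReal_le_neg (hX i)) hlower ?_ (fun t _ => hlim (-t)) hrem
    filter_upwards [hlow] with i hi t ht
    rw [Real.norm_of_nonneg measureReal_nonneg]
    exact hi t ht

end DominatedConvergence

section GumbelMean

theorem integral_log_mul_exp_neg :
    ∫ t in Set.Ioi (0 : ℝ), Real.log t * Real.exp (-t) = -Real.eulerMascheroniConstant := by
  have hGamma : HasDerivAt Complex.GammaIntegral (-Real.eulerMascheroniConstant) 1 := by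
    refine Complex.hasDerivAt_Gamma_one.congr_of_eventuallyEq ?_
    filter_upwards [(isOpen_lt continuous_const Complex.continuous_re).mem_nhds
      (show (0 : ℝ) < (1 : ℂ).re by simp)] with z hz
    exact (Complex.Gamma_eq_integral hz).symm
  have hcomplex := (Complex.hasDerivAt_GammaIntegral (s := 1) (by simp)).unique hGamma
  have hreal : (∫ t : ℝ in Set.Ioi 0,
      (t : ℂ) ^ ((1 : ℂ) - 1) * ((Real.log t : ℂ) * (Real.exp (-t) : ℂ)))
      = ((∫ t in Set.Ioi (0 : ℝ), Real.log t * Real.exp (-t) : ℝ) : ℂ) := by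
    rw [← integral_complex_ofReal]
    exact integral_congr_ae (Eventually.of_forall fun t => by simp)
  rw [hreal] at hcomplex
  exact_mod_cast hcomplex

theorem integral_expMeasure {r : ℝ} (hr : 0 < r) (f : ℝ → ℝ) :
    ∫ x, f x ∂(expMeasure r) = ∫ x in Set.Ioi (0 : ℝ), f x * (r * Real.exp (-(r * x))) := by
  have hdef : expMeasure r = volume.withDensity (exponentialPDF r) := rfl
  have hmeas : Measurable (exponentialPDF r) :=
    (measurable_exponentialPDFReal r).ennreal_ofReal
  rw [hdef, integral_withDensity_eq_integral_toReal_smul hmeas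
    (Eventually.of_forall fun x => ENNReal.ofReal_lt_top), ← integral_Ici_eq_integral_Ioi,
    ← integral_indicator measurableSet_Ici]
  refine integral_congr_ae (Eventually.of_forall fun x => ?_)
  by_cases hx : 0 ≤ x
  · simp only [smul_eq_mul, Set.indicator_of_mem (Set.mem_Ici.mpr hx),
      exponentialPDF_of_nonneg hx]
    rw [ENNReal.toReal_ofReal (by positivity), mul_comm]
  · simp only [smul_eq_mul, Set.indicator_of_notMem (mt Set.mem_Ici.mp hx),
      exponentialPDF_of_neg (not_le.mp hx), ENNReal.toReal_zero, zero_mul]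

theorem expMeasure_real_Iic {r x : ℝ} (hr : 0 < r) (hx : 0 ≤ x) :
    (expMeasure r).real (Set.Iic x) = 1 - Real.exp (-(r * x)) := by
  have := isProbabilityMeasure_expMeasure hr
  rw [← cdf_eq_real, cdf_expMeasure_eq hr, if_pos hx]

theorem ae_pos_expMeasure {r : ℝ} (hr : 0 < r) : ∀ᵐ x ∂(expMeasure r), 0 < x := by
  have := isProbabilityMeasure_expMeasure hr
  have hzero := expMeasure_real_Iic hr le_rfl
  rw [mul_zero, neg_zero, Real.exp_zero, sub_self, measureReal_eq_zero_iff] at hzero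
  filter_upwards [measure_eq_zero_iff_ae_notMem.mp hzero] with x hx
  exact not_le.mp hx

theorem expMeasure_real_neg_log_le (t : ℝ) :
    (expMeasure 1).real {x | -Real.log x ≤ t} = Real.exp (-Real.exp (-t)) := by
  have := isProbabilityMeasure_expMeasure one_pos
  have hsingle : expMeasure 1 {Real.exp (-t)} = 0 :=
    withDensity_absolutelyContinuous volume (gammaPDF 1 1) (measure_singleton _)
  have hset : (expMeasure 1).real {x | -Real.log x ≤ t}
      = (expMeasure 1).real (Set.Iic (Real.exp (-t)))ᶜ := by
    refine measureReal_congr ?_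
    filter_upwards [ae_pos_expMeasure one_pos, measure_eq_zero_iff_ae_notMem.mp hsingle]
      with x hpos hne
    refine propext ?_
    change -Real.log x ≤ t ↔ ¬ x ≤ Real.exp (-t)
    rw [neg_le, Real.le_log_iff_exp_le hpos, not_le]
    exact ⟨fun h => lt_of_le_of_ne h (Ne.symm hne), le_of_lt⟩
  rw [hset, probReal_compl_eq_one_sub measurableSet_Iic,
    expMeasure_real_Iic one_pos (Real.exp_pos _).le, one_mul, sub_sub_cancel]

theorem gumbel_integral_tails_eq_eulerMascheroniConstant :
    (∫ t in Set.Ioi (0 : ℝ), (1 - Real.exp (-Real.exp (-t))))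
      - ∫ t in Set.Ioi (0 : ℝ), Real.exp (-Real.exp (-(-t))) = Real.eulerMascheroniConstant := by
  have := isProbabilityMeasure_expMeasure one_pos
  have hmean : ∫ x, -Real.log x ∂(expMeasure 1) = Real.eulerMascheroniConstant := by
    simp only [integral_expMeasure one_pos, neg_mul, one_mul, integral_neg,
      integral_log_mul_exp_neg, neg_neg]
  have hint : Integrable (fun x => -Real.log x) (expMeasure 1) :=
    .of_integral_ne_zero (hmean ▸ (one_half_pos.trans Real.one_half_lt_eulerMascheroniConstant).ne')
  simpa only [hmean, expMeasure_real_neg_log_le] using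
    (integral_eq_integral_one_sub_cdf_sub_integral_cdf hint).symm

end GumbelMean

section GaussianTail

/-- The upper tail `Q` of the standard Gaussian law. -/
noncomputable def gaussianTail (z : ℝ) : ℝ :=
  (gaussianReal 0 1).real (Set.Ioi z)

theorem gaussianTail_eq_integral (z : ℝ) :
    gaussianTail z = ∫ u in Set.Ioi z, gaussianPDFReal 0 1 u := by
  rw [gaussianTail, measureReal_def, gaussianReal_apply_eq_integral 0 one_ne_zero,
    ENNReal.toReal_ofReal (integral_nonneg fun u => gaussianPDFReal_nonneg 0 1 u)]

theorem gaussianTail_pos (z : ℝ) : 0 < gaussianTail z := by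
  have hnull : gaussianReal 0 1 (Set.Ioi z) ≠ 0 := fun h =>
    (isOpen_Ioi.measure_pos volume Set.nonempty_Ioi).ne'
      (gaussianReal_absolutelyContinuous' 0 one_ne_zero h)
  exact ENNReal.toReal_pos hnull (measure_ne_top _ _)

theorem antitone_gaussianTail : Antitone gaussianTail := fun _ _ h =>
  measureReal_mono (Set.Ioi_subset_Ioi h)

theorem gaussianPDFReal_zero_one (u : ℝ) :
    gaussianPDFReal 0 1 u = (√(2 * Real.pi))⁻¹ * Real.exp (-(u ^ 2 / 2)) := by
  simp only [gaussianPDFReal, NNReal.coe_one, mul_one, sub_zero, neg_div]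

theorem gaussianPDFReal_zero_one_add (u h : ℝ) :
    gaussianPDFReal 0 1 (u + h)
      = gaussianPDFReal 0 1 u * Real.exp (-(u * h) - h ^ 2 / 2) := by
  rw [gaussianPDFReal_zero_one, gaussianPDFReal_zero_one, mul_assoc, ← Real.exp_add]
  ring_nf

theorem gaussianTail_add_le (z : ℝ) {h : ℝ} (hh : 0 ≤ h) :
    gaussianTail (z + h) ≤ gaussianTail z * Real.exp (-(z * h)) := by
  have hshift : gaussianTail (z + h) = ∫ u in Set.Ioi z, gaussianPDFReal 0 1 (u + h) := by
    rw [gaussianTail_eq_integral, ← (measurePreserving_add_right volume h).setIntegral_preimage_emb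
      (measurableEmbedding_addRight h), Set.preimage_add_const_Ioi, add_sub_cancel_right]
  rw [hshift, gaussianTail_eq_integral, ← integral_mul_const]
  refine setIntegral_mono_on ((integrable_gaussianPDFReal 0 1).comp_add_right h).integrableOn
    ((integrable_gaussianPDFReal 0 1).mul_const _).integrableOn measurableSet_Ioi
    fun u (hu : z < u) => ?_
  rw [gaussianPDFReal_zero_one_add]
  refine mul_le_mul_of_nonneg_left (Real.exp_le_exp.mpr ?_) (gaussianPDFReal_nonneg 0 1 u)
  linarith [mul_le_mul_of_nonneg_right hu.le hh, sq_nonneg h]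

theorem gaussianTail_add_div_le {s t z : ℝ} (hs : 0 < s) (ht : 0 ≤ t) (hz : s / 2 ≤ z) :
    gaussianTail (z + t / s) ≤ gaussianTail z * Real.exp (-(t / 2)) := by
  refine (gaussianTail_add_le z (div_nonneg ht hs.le)).trans
    (mul_le_mul_of_nonneg_left (Real.exp_le_exp.mpr (neg_le_neg ?_)) (gaussianTail_pos z).le)
  calc t / 2 = s / 2 * (t / s) := by field_simp
    _ ≤ z * (t / s) := mul_le_mul_of_nonneg_right hz (div_nonneg ht hs.le)

theorem tendsto_gaussianTail_comp_div_gaussianTail {δ : ℝ} (hδ : 0 < δ) {w : ℝ → ℝ}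
    (hw : ∀ᶠ z in atTop, z + δ ≤ w z) :
    Tendsto (fun z => gaussianTail (w z) / gaussianTail z) atTop (𝓝 0) := by
  have hexp : Tendsto (fun z : ℝ => Real.exp (-(z * δ))) atTop (𝓝 0) :=
    Real.tendsto_exp_neg_atTop_nhds_zero.comp (tendsto_id.atTop_mul_const hδ)
  refine squeeze_zero' (Eventually.of_forall fun z =>
    div_nonneg (gaussianTail_pos _).le (gaussianTail_pos _).le) ?_ hexp
  filter_upwards [hw] with z hz
  rw [div_le_iff₀' (gaussianTail_pos z)]
  exact (antitone_gaussianTail hz).trans (gaussianTail_add_le z hδ.le)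

theorem hasDerivAt_gaussianPDFReal_div_self {u : ℝ} (hu : u ≠ 0) :
    HasDerivAt (fun u => gaussianPDFReal 0 1 u / u)
      (-((1 + (u ^ 2)⁻¹) * gaussianPDFReal 0 1 u)) u := by
  have hexp : HasDerivAt (fun u : ℝ => (√(2 * Real.pi))⁻¹ * Real.exp (-(u ^ 2 / 2)))
      ((√(2 * Real.pi))⁻¹ * (Real.exp (-(u ^ 2 / 2)) * -(2 * u / 2))) u := by
    simpa using (((hasDerivAt_pow 2 u).div_const 2).neg.exp).const_mul (√(2 * Real.pi))⁻¹
  simp only [gaussianPDFReal_zero_one]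
  refine (hexp.div (hasDerivAt_id u) hu).congr_deriv ?_
  simp only [id]
  field_simp
  ring

theorem tendsto_gaussianPDFReal_div_self :
    Tendsto (fun u => gaussianPDFReal 0 1 u / u) atTop (𝓝 0) := by
  have hbound : Tendsto (fun u : ℝ => (√(2 * Real.pi))⁻¹ * u⁻¹) atTop (𝓝 0) := by
    simpa only [mul_zero] using tendsto_inv_atTop_zero.const_mul (√(2 * Real.pi))⁻¹
  refine squeeze_zero' ?_ ?_ hbound
  · filter_upwards [eventually_ge_atTop 0] with u hu
    exact div_nonneg (gaussianPDFReal_nonneg 0 1 u) hu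
  · filter_upwards [eventually_ge_atTop 0] with u hu
    rw [gaussianPDFReal_zero_one, div_eq_mul_inv]
    gcongr
    exact mul_le_of_le_one_right (by positivity) (Real.exp_le_one_iff.mpr (by
      rw [neg_nonpos]; positivity))

theorem integrableOn_one_add_inv_sq_mul_gaussianPDFReal {z : ℝ} (hz : 0 < z) :
    IntegrableOn (fun u => (1 + (u ^ 2)⁻¹) * gaussianPDFReal 0 1 u) (Set.Ioi z) :=
  integrable_neg_iff.mp <| integrableOn_Ioi_deriv_of_nonpos'
    (fun u hu => hasDerivAt_gaussianPDFReal_div_self (hz.trans_le hu).ne')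
    (fun u _ => neg_nonpos.mpr (mul_nonneg (by positivity) (gaussianPDFReal_nonneg 0 1 u)))
    tendsto_gaussianPDFReal_div_self

theorem integral_Ioi_one_add_inv_sq_mul_gaussianPDFReal {z : ℝ} (hz : 0 < z) :
    ∫ u in Set.Ioi z, (1 + (u ^ 2)⁻¹) * gaussianPDFReal 0 1 u = gaussianPDFReal 0 1 z / z := by
  have hneg := integral_Ioi_of_hasDerivAt_of_tendsto'
    (fun u hu => hasDerivAt_gaussianPDFReal_div_self (hz.trans_le hu).ne')
    (integrableOn_one_add_inv_sq_mul_gaussianPDFReal hz).neg tendsto_gaussianPDFReal_div_self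
  rwa [integral_neg, zero_sub, neg_inj] at hneg

theorem gaussianTail_le_gaussianPDFReal_div {z : ℝ} (hz : 0 < z) :
    gaussianTail z ≤ gaussianPDFReal 0 1 z / z := by
  have hint := integrableOn_one_add_inv_sq_mul_gaussianPDFReal hz
  rw [← integral_Ioi_one_add_inv_sq_mul_gaussianPDFReal hz, gaussianTail_eq_integral]
  refine setIntegral_mono_on (integrable_gaussianPDFReal 0 1).integrableOn hint
    measurableSet_Ioi fun u _ => ?_
  exact le_mul_of_one_le_left (gaussianPDFReal_nonneg 0 1 u)
    (le_add_of_nonneg_right (by positivity))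

theorem gaussianPDFReal_div_le_mul_gaussianTail {z : ℝ} (hz : 0 < z) :
    gaussianPDFReal 0 1 z / z ≤ (1 + (z ^ 2)⁻¹) * gaussianTail z := by
  have hint := integrableOn_one_add_inv_sq_mul_gaussianPDFReal hz
  rw [← integral_Ioi_one_add_inv_sq_mul_gaussianPDFReal hz, gaussianTail_eq_integral,
    ← integral_const_mul]
  refine setIntegral_mono_on hint ((integrable_gaussianPDFReal 0 1).const_mul _).integrableOn
    measurableSet_Ioi fun u (hu : z < u) => ?_
  have := gaussianPDFReal_nonneg 0 1 u
  gcongr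

theorem tendsto_mul_gaussianTail_div_gaussianPDFReal :
    Tendsto (fun z => z * gaussianTail z / gaussianPDFReal 0 1 z) atTop (𝓝 1) := by
  have hlower : Tendsto (fun z : ℝ => (1 + (z ^ 2)⁻¹)⁻¹) atTop (𝓝 1) := by
    simpa using ((tendsto_inv_atTop_zero.comp (tendsto_pow_atTop two_ne_zero)).const_add
      (1 : ℝ)).inv₀ (by simp)
  refine tendsto_of_tendsto_of_tendsto_of_le_of_le' hlower tendsto_const_nhds ?_ ?_
  · filter_upwards [eventually_gt_atTop 0] with z hz
    have hφ := gaussianPDFReal_pos 0 1 z one_ne_zero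
    have hmills := gaussianPDFReal_div_le_mul_gaussianTail hz
    rw [div_le_iff₀ hz] at hmills
    rw [inv_le_iff_one_le_mul₀' (by positivity), mul_div_assoc', one_le_div hφ]
    linarith
  · filter_upwards [eventually_gt_atTop 0] with z hz
    rw [div_le_one (gaussianPDFReal_pos 0 1 z one_ne_zero), ← le_div_iff₀' hz]
    exact gaussianTail_le_gaussianPDFReal_div hz

theorem gaussianReal_eq_map_gaussianReal_zero_one (m s : ℝ) :
    gaussianReal m (.mk (s ^ 2) (sq_nonneg s)) = (gaussianReal 0 1).map fun y => s * y + m := by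
  have hscale := gaussianReal_map_const_mul (μ := 0) (v := 1) s
  have hshift := gaussianReal_map_add_const (μ := s * 0) (v := .mk (s ^ 2) (sq_nonneg s) * 1) m
  rw [← hscale, Measure.map_map (by fun_prop) (by fun_prop), mul_zero, zero_add, mul_one] at hshift
  exact hshift.symm

theorem gaussianCDF_eq_real (m s x : ℝ) :
    gaussianCDF m s x = (gaussianReal m (.mk (s ^ 2) (sq_nonneg s))).real (Set.Iic x) :=
  cdf_eq_real (gaussianReal m (.mk (s ^ 2) (sq_nonneg s))) x

theorem one_sub_gaussianCDF (m : ℝ) {s : ℝ} (hs : 0 < s) (x : ℝ) :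
    1 - gaussianCDF m s x = gaussianTail ((x - m) / s) := by
  have hpre : (fun y => s * y + m) ⁻¹' Set.Iic x = Set.Iic ((x - m) / s) := by
    ext y
    simp only [Set.mem_preimage, Set.mem_Iic, le_div_iff₀' hs, le_sub_iff_add_le]
  rw [gaussianCDF_eq_real, gaussianReal_eq_map_gaussianReal_zero_one,
    map_measureReal_apply (by fun_prop) measurableSet_Iic, hpre,
    ← probReal_compl_eq_one_sub measurableSet_Iic, Set.compl_Iic, gaussianTail]

end GaussianTail

section GumbelLevel

/-- The level `ℓ` with `exp (s ^ 2 / 2) * (p * Q ℓ) ≈ exp (-t)`, where `Q` is the standard Gaussian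
tail: up to the negligible square of the correction `ℓ - s`, it solves
`exp (s ^ 2 / 2) * (p * φ ℓ) = s * exp (-t)` for the standard Gaussian density `φ`. -/
noncomputable def gumbelLevel (p s t : ℝ) : ℝ :=
  s + (t - Real.log (√(2 * Real.pi) * s / p)) / s

theorem gumbelLevel_add (p s t u : ℝ) :
    gumbelLevel p s (t + u) = gumbelLevel p s t + u / s := by
  simp only [gumbelLevel]
  ring

variable {p : ℝ} (hp : 0 < p)
include hp

theorem tendsto_gumbelLevel_sub_self (t : ℝ) :
    Tendsto (fun s => gumbelLevel p s t - s) atTop (𝓝 0) := by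
  have hconst : Tendsto (fun s : ℝ => (t - Real.log (√(2 * Real.pi) / p)) / s) atTop (𝓝 0) :=
    tendsto_const_nhds.div_atTop tendsto_id
  have hlog : Tendsto (fun s : ℝ => Real.log s / s) atTop (𝓝 0) :=
    Real.isLittleO_log_id_atTop.tendsto_div_nhds_zero
  rw [← sub_zero (0 : ℝ)]
  refine (hconst.sub hlog).congr' ?_
  filter_upwards [eventually_gt_atTop 0] with s hs
  rw [gumbelLevel, add_sub_cancel_left, mul_div_right_comm,
    Real.log_mul (by positivity) hs.ne', ← sub_div, sub_sub]

theorem tendsto_gumbelLevel_atTop (t : ℝ) : Tendsto (fun s => gumbelLevel p s t) atTop atTop := by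
  simpa only [sub_add_cancel, id] using (tendsto_gumbelLevel_sub_self hp t).add_atTop tendsto_id

theorem tendsto_gumbelLevel_div_self (t : ℝ) :
    Tendsto (fun s => gumbelLevel p s t / s) atTop (𝓝 1) := by
  have hsmall : Tendsto (fun s => (gumbelLevel p s t - s) / s + 1) atTop (𝓝 1) := by
    simpa only [zero_add, id] using
      ((tendsto_gumbelLevel_sub_self hp t).div_atTop tendsto_id).add_const 1
  refine hsmall.congr' ?_
  filter_upwards [eventually_gt_atTop 0] with s hs
  rw [sub_div, div_self hs.ne', sub_add_cancel]

theorem exp_mul_gaussianPDFReal_gumbelLevel {s : ℝ} (hs : 0 < s) (t : ℝ) :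
    Real.exp (s ^ 2 / 2) * (p * gaussianPDFReal 0 1 (gumbelLevel p s t))
      = s * Real.exp (-t) * Real.exp (-((gumbelLevel p s t - s) ^ 2 / 2)) := by
  set h := gumbelLevel p s t - s with hh
  have hlevel : gumbelLevel p s t = s + h := by rw [hh, add_sub_cancel]
  have hcorr : s * h = t - Real.log (√(2 * Real.pi) * s / p) := by
    rw [hh, gumbelLevel, add_sub_cancel_left, mul_div_cancel₀ _ hs.ne']
  have hexp : Real.exp (-(s * h)) = Real.exp (-t) * (√(2 * Real.pi) * s / p) := by
    rw [hcorr, neg_sub, sub_eq_neg_add, Real.exp_add, Real.exp_log (by positivity)]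
  rw [hlevel, gaussianPDFReal_zero_one_add, gaussianPDFReal_zero_one, sub_eq_add_neg,
    Real.exp_add (-(s * h)), hexp, Real.exp_neg (s ^ 2 / 2)]
  field_simp

variable {H : ℝ → ℝ} (hH : Tendsto (fun z => H z / gaussianTail z) atTop (𝓝 p))
include hH

theorem tendsto_exp_mul_gumbelLevel (t : ℝ) :
    Tendsto (fun s => Real.exp (s ^ 2 / 2) * H (gumbelLevel p s t)) atTop
      (𝓝 (Real.exp (-t))) := by
  have hlevel := tendsto_gumbelLevel_atTop hp t
  have hratio := hH.comp hlevel
  have hmills := tendsto_mul_gaussianTail_div_gaussianPDFReal.comp hlevel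
  have hinv := (tendsto_gumbelLevel_div_self hp t).inv₀ one_ne_zero
  have hcorr : Tendsto (fun s => Real.exp (-((gumbelLevel p s t - s) ^ 2 / 2))) atTop (𝓝 1) := by
    simpa using (((tendsto_gumbelLevel_sub_self hp t).pow 2).div_const 2).neg.rexp
  have hprod := (((hratio.div_const p).mul hmills).mul hinv).mul (hcorr.const_mul (Real.exp (-t)))
  rw [div_self hp.ne', inv_one, one_mul, one_mul, one_mul, mul_one] at hprod
  refine hprod.congr' ?_
  filter_upwards [eventually_gt_atTop 0, hlevel.eventually_gt_atTop 0] with s hs hz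
  have hφ := gaussianPDFReal_pos 0 1 (gumbelLevel p s t) one_ne_zero
  have hQ := gaussianTail_pos (gumbelLevel p s t)
  have hdensity := exp_mul_gaussianPDFReal_gumbelLevel hp hs t
  simp only [Function.comp_apply]
  field_simp
  linear_combination (-H (gumbelLevel p s t)) * hdensity

theorem eventually_forall_add_div_le :
    ∀ᶠ s in atTop, ∀ z, s / 2 ≤ z → ∀ t, 0 ≤ t →
      H (z + t / s) ≤ 4 * Real.exp (-(t / 2)) * H z := by
  have hbounds : ∀ᶠ z in atTop, p / 2 ≤ H z / gaussianTail z ∧ H z / gaussianTail z ≤ 2 * p :=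
    (hH.eventually (eventually_ge_nhds (half_lt_self hp))).and
      (hH.eventually (eventually_le_nhds (lt_two_mul_self hp)))
  obtain ⟨z₀, hz₀⟩ := eventually_atTop.mp hbounds
  filter_upwards [eventually_gt_atTop 0, eventually_ge_atTop (2 * z₀)] with s hs hsz z hz t ht
  have hupper : H (z + t / s) ≤ 2 * p * gaussianTail (z + t / s) :=
    (div_le_iff₀ (gaussianTail_pos _)).mp (hz₀ _ (by have := div_nonneg ht hs.le; linarith)).2
  have hlower : p / 2 * gaussianTail z ≤ H z :=
    (le_div_iff₀ (gaussianTail_pos _)).mp (hz₀ _ (by linarith)).1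
  calc H (z + t / s) ≤ 2 * p * (gaussianTail z * Real.exp (-(t / 2))) :=
        hupper.trans (by gcongr; exact gaussianTail_add_div_le hs ht hz)
    _ = 4 * Real.exp (-(t / 2)) * (p / 2 * gaussianTail z) := by ring
    _ ≤ 4 * Real.exp (-(t / 2)) * H z := by gcongr

theorem eventually_forall_exp_mul_gumbelLevel_le :
    ∀ᶠ s in atTop, ∀ t, 0 ≤ t →
      Real.exp (s ^ 2 / 2) * H (gumbelLevel p s t) ≤ 8 * Real.exp (-(t / 2)) := by
  have hzero := tendsto_exp_mul_gumbelLevel hp hH 0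
  rw [neg_zero, Real.exp_zero] at hzero
  filter_upwards [eventually_gt_atTop 0, eventually_forall_add_div_le hp hH,
    hzero.eventually (eventually_le_nhds one_lt_two),
    (tendsto_gumbelLevel_div_self hp 0).eventually (eventually_ge_nhds one_half_lt_one)]
    with s hs hdecay hle hdiv t ht
  have hhalf : s / 2 ≤ gumbelLevel p s 0 := by
    rw [le_div_iff₀ hs] at hdiv
    linarith
  have hstep := hdecay _ hhalf t ht
  rw [← gumbelLevel_add, zero_add] at hstep
  calc Real.exp (s ^ 2 / 2) * H (gumbelLevel p s t)
      ≤ Real.exp (s ^ 2 / 2) * (4 * Real.exp (-(t / 2)) * H (gumbelLevel p s 0)) := by gcongr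
    _ = 4 * Real.exp (-(t / 2)) * (Real.exp (s ^ 2 / 2) * H (gumbelLevel p s 0)) := by ring
    _ ≤ 4 * Real.exp (-(t / 2)) * 2 := by gcongr
    _ = 8 * Real.exp (-(t / 2)) := by ring

theorem eventually_forall_le_exp_mul_gumbelLevel_neg :
    ∀ᶠ s in atTop, ∀ t, 0 ≤ t → t ≤ s ^ 2 / 4 →
      1 / 8 * Real.exp (t / 2) ≤ Real.exp (s ^ 2 / 2) * H (gumbelLevel p s (-t)) := by
  have hzero := tendsto_exp_mul_gumbelLevel hp hH 0
  rw [neg_zero, Real.exp_zero] at hzero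
  filter_upwards [eventually_gt_atTop 0, eventually_forall_add_div_le hp hH,
    hzero.eventually (eventually_ge_nhds one_half_lt_one),
    (tendsto_gumbelLevel_div_self hp 0).eventually (eventually_ge_nhds
      (show (3 / 4 : ℝ) < 1 by norm_num))] with s hs hdecay hge hdiv t ht hts
  have hback : gumbelLevel p s 0 = gumbelLevel p s (-t) + t / s := by
    rw [← gumbelLevel_add, neg_add_cancel]
  have hhalf : s / 2 ≤ gumbelLevel p s (-t) := by
    have hshift : t / s ≤ s / 4 := by
      rw [div_le_iff₀ hs]
      linarith
    rw [le_div_iff₀ hs, hback] at hdiv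
    linarith
  have hstep := hdecay _ hhalf t ht
  rw [← hback] at hstep
  calc 1 / 8 * Real.exp (t / 2) = 1 / 4 * Real.exp (t / 2) * (1 / 2) := by ring
    _ ≤ 1 / 4 * Real.exp (t / 2) * (Real.exp (s ^ 2 / 2) * H (gumbelLevel p s 0)) := by gcongr
    _ ≤ 1 / 4 * Real.exp (t / 2) * (Real.exp (s ^ 2 / 2)
          * (4 * Real.exp (-(t / 2)) * H (gumbelLevel p s (-t)))) := by gcongr
    _ = Real.exp (s ^ 2 / 2) * H (gumbelLevel p s (-t)) := by
        rw [Real.exp_neg]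
        field_simp

end GumbelLevel

section NormalizingConstants

theorem tendsto_sqrt_two_mul_log : Tendsto (fun K : ℕ => √(2 * Real.log K)) atTop atTop :=
  Real.tendsto_sqrt_atTop.comp ((Real.tendsto_log_atTop.comp
    tendsto_natCast_atTop_atTop).const_mul_atTop two_pos)

theorem sqrt_two_mul_log_natCast_sq (K : ℕ) : √(2 * Real.log K) ^ 2 = 2 * Real.log K :=
  Real.sq_sqrt (mul_nonneg zero_le_two (Real.log_natCast_nonneg K))

theorem exp_sqrt_two_mul_log_sq_half {K : ℕ} (hK : 0 < K) :
    Real.exp (√(2 * Real.log K) ^ 2 / 2) = K := by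
  rw [sqrt_two_mul_log_natCast_sq, mul_div_cancel_left₀ _ two_ne_zero,
    Real.exp_log (Nat.cast_pos.mpr hK)]

theorem tendsto_scaleConst {σ : ℝ} (hσ : 0 < σ) : Tendsto (scaleConst σ) atTop atTop :=
  tendsto_sqrt_two_mul_log.atTop_div_const hσ

theorem log_sqrt_two_pi_mul_sqrt_two_mul_log_div {p : ℝ} (hp : 0 < p) {K : ℕ} (hK : 2 ≤ K) :
    Real.log (√(2 * Real.pi) * √(2 * Real.log K) / p)
      = (Real.log (Real.log K) + Real.log (4 * Real.pi / p ^ 2)) / 2 := by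
  have hlog : 0 < Real.log K := Real.log_pos (Nat.one_lt_cast.mpr hK)
  have hsq := Real.log_pow (√(2 * Real.pi) * √(2 * Real.log K) / p) 2
  rw [div_pow, mul_pow, sqrt_two_mul_log_natCast_sq, Real.sq_sqrt (by positivity)] at hsq
  rw [← Real.log_mul hlog.ne' (by positivity), eq_div_iff two_ne_zero, mul_comm _ (2 : ℝ)]
  refine hsq.symm.trans (congrArg Real.log ?_)
  ring

theorem locConst_add_div_scaleConst {p : ℝ} (hp : 0 < p) (μ σ : ℝ) {K : ℕ} (hK : 2 ≤ K) (t : ℝ) :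
    locConst p μ σ K + t / scaleConst σ K
      = μ + σ * gumbelLevel p √(2 * Real.log K) t := by
  have hlog : 0 < Real.log K := Real.log_pos (Nat.one_lt_cast.mpr hK)
  have : 0 < √(2 * Real.log K) := Real.sqrt_pos.mpr (by positivity)
  rw [gumbelLevel, log_sqrt_two_pi_mul_sqrt_two_mul_log_div hp hK, locConst, scaleConst]
  field_simp
  ring

variable {p μ σ : ℝ} (hp : 0 < p) {F : ℝ → ℝ}
  (hF : Tendsto (fun z => (1 - F (μ + σ * z)) / gaussianTail z) atTop (𝓝 p))
include hp hF

theorem tendsto_natCast_mul_one_sub (t : ℝ) :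
    Tendsto (fun K : ℕ => (K : ℝ) * (1 - F (locConst p μ σ K + t / scaleConst σ K))) atTop
      (𝓝 (Real.exp (-t))) := by
  refine ((tendsto_exp_mul_gumbelLevel hp hF t).comp tendsto_sqrt_two_mul_log).congr' ?_
  filter_upwards [eventually_ge_atTop 2] with K hK
  rw [Function.comp_apply, exp_sqrt_two_mul_log_sq_half (two_pos.trans_le hK),
    locConst_add_div_scaleConst hp μ σ hK]

theorem eventually_forall_natCast_mul_one_sub_le :
    ∀ᶠ K : ℕ in atTop, ∀ t, 0 ≤ t →
      (K : ℝ) * (1 - F (locConst p μ σ K + t / scaleConst σ K)) ≤ 8 * Real.exp (-(t / 2)) := by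
  filter_upwards [tendsto_sqrt_two_mul_log.eventually
    (eventually_forall_exp_mul_gumbelLevel_le hp hF), eventually_ge_atTop 2] with K hle hK t ht
  have h := hle t ht
  rwa [exp_sqrt_two_mul_log_sq_half (two_pos.trans_le hK),
    ← locConst_add_div_scaleConst hp μ σ hK] at h

theorem eventually_forall_le_natCast_mul_one_sub_neg :
    ∀ᶠ K : ℕ in atTop, ∀ t, 0 ≤ t → t ≤ Real.log K / 2 →
      1 / 8 * Real.exp (t / 2)
        ≤ (K : ℝ) * (1 - F (locConst p μ σ K + -t / scaleConst σ K)) := by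
  filter_upwards [tendsto_sqrt_two_mul_log.eventually
    (eventually_forall_le_exp_mul_gumbelLevel_neg hp hF), eventually_ge_atTop 2]
    with K hge hK t ht htK
  have h := hge t ht (by rw [sqrt_two_mul_log_natCast_sq]; linarith)
  rwa [exp_sqrt_two_mul_log_sq_half (two_pos.trans_le hK),
    ← locConst_add_div_scaleConst hp μ σ hK] at h

end NormalizingConstants

section Maximum

variable {Ω : Type*} {mΩ : MeasurableSpace Ω} {P : Measure Ω} {C : ℕ → Ω → ℝ}

theorem integrable_maxCapacity (hC : ∀ i, Integrable (C i) P) (K : ℕ) :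
    Integrable (maxCapacity C K) P := by
  have hmeas : AEMeasurable (maxCapacity C K) P :=
    AEMeasurable.iSup fun i : Fin K => (hC i).aemeasurable
  refine (integrable_finsetSum Finset.univ fun (i : Fin K) _ => (hC i).abs).mono'
    hmeas.aestronglyMeasurable (Eventually.of_forall fun ω => ?_)
  rw [Real.norm_eq_abs, maxCapacity]
  rcases isEmpty_or_nonempty (Fin K) with hempty | hnonempty
  · simp
  · obtain ⟨i, hi⟩ := exists_eq_ciSup_of_finite (f := fun i : Fin K => C i ω)
    rw [← hi]
    exact Finset.single_le_sum (f := fun i : Fin K => |C i ω|) (fun _ _ => abs_nonneg _)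
      (Finset.mem_univ i)

theorem maxCapacity_le_iff {K : ℕ} (hK : 0 < K) {ω : Ω} {x : ℝ} :
    maxCapacity C K ω ≤ x ↔ ∀ i < K, C i ω ≤ x := by
  have : Nonempty (Fin K) := ⟨⟨0, hK⟩⟩
  rw [maxCapacity, ciSup_le_iff (Set.finite_range _).bddAbove]
  exact Fin.forall_iff

theorem pow_le_exp_neg_mul_one_sub {y : ℝ} (hy : 0 ≤ y) (n : ℕ) :
    y ^ n ≤ Real.exp (-(n * (1 - y))) := by
  rw [← mul_neg, Real.exp_nat_mul]
  refine pow_le_pow_left₀ hy ?_ n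
  simpa only [sub_sub_cancel] using Real.one_sub_le_exp_neg (1 - y)

theorem setOf_mul_sub_le_eq {a : ℝ} (ha : 0 < a) (X : Ω → ℝ) (b t : ℝ) :
    {ω | a * (X ω - b) ≤ t} = {ω | X ω ≤ b + t / a} := by
  ext ω
  rw [Set.mem_ofPred_eq, Set.mem_ofPred_eq, ← sub_le_iff_le_add', le_div_iff₀' ha]

variable (hindep : iIndepFun C P) {F : ℝ → ℝ} (hlaw : ∀ i x, P.real {ω | C i ω ≤ x} = F x)

include hlaw in
theorem nonneg_of_measureReal_le (x : ℝ) : 0 ≤ F x :=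
  hlaw 0 x ▸ measureReal_nonneg

include hindep hlaw

theorem measureReal_maxCapacity_le {K : ℕ} (hK : 0 < K) (x : ℝ) :
    P.real {ω | maxCapacity C K ω ≤ x} = F x ^ K := by
  have hset : {ω | maxCapacity C K ω ≤ x} = ⋂ i ∈ Finset.range K, C i ⁻¹' Set.Iic x := by
    ext ω
    simp only [Set.mem_ofPred_eq, maxCapacity_le_iff hK, Set.mem_iInter, Set.mem_preimage,
      Set.mem_Iic, Finset.mem_range]
  have hlaw' : ∀ i, (P (C i ⁻¹' Set.Iic x)).toReal = F x := fun i => hlaw i x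
  rw [hset, measureReal_def, hindep.measure_inter_preimage_eq_mul (Finset.range K)
    (sets := fun _ => Set.Iic x) (fun _ _ => measurableSet_Iic), ENNReal.toReal_prod,
    Finset.prod_eq_pow_card fun i _ => hlaw' i, Finset.card_range]

theorem tendsto_measureReal_maxCapacity_le {u : ℕ → ℝ} {τ : ℝ}
    (hu : Tendsto (fun K : ℕ => (K : ℝ) * (1 - F (u K))) atTop (𝓝 τ)) :
    Tendsto (fun K => P.real {ω | maxCapacity C K ω ≤ u K}) atTop (𝓝 (Real.exp (-τ))) := by
  have hneg : Tendsto (fun K : ℕ => (K : ℝ) * (F (u K) - 1)) atTop (𝓝 (-τ)) :=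
    hu.neg.congr fun K => by rw [← mul_neg, neg_sub]
  refine (Real.tendsto_one_add_pow_exp_of_tendsto hneg).congr' ?_
  filter_upwards [eventually_gt_atTop 0] with K hK
  rw [measureReal_maxCapacity_le hindep hlaw hK, add_sub_cancel]

theorem one_sub_measureReal_maxCapacity_le_le {K : ℕ} (hK : 0 < K) (x : ℝ) :
    1 - P.real {ω | maxCapacity C K ω ≤ x} ≤ K * (1 - F x) := by
  have hbernoulli := one_add_mul_le_pow (a := F x - 1)
    (by linarith [nonneg_of_measureReal_le hlaw x]) K
  rw [add_sub_cancel] at hbernoulli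
  rw [measureReal_maxCapacity_le hindep hlaw hK]
  linarith

theorem measureReal_maxCapacity_le_le_exp {K : ℕ} (hK : 0 < K) (x : ℝ) :
    P.real {ω | maxCapacity C K ω ≤ x} ≤ Real.exp (-(K * (1 - F x))) :=
  (measureReal_maxCapacity_le hindep hlaw hK x).trans_le
    (pow_le_exp_neg_mul_one_sub (nonneg_of_measureReal_le hlaw x) K)

/-- One variable is kept to make the tail integrable; the other `K - 1` provide the small factor. -/
theorem setIntegral_measureReal_maxCapacity_le [IsProbabilityMeasure P] (hC : Integrable (C 0) P)
    {K : ℕ} (hK : 0 < K) {a T : ℝ} (ha : 0 < a) (hT : 0 ≤ T) (b : ℝ) :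
    ∫ t in Set.Ioi T, P.real {ω | a * (maxCapacity C K ω - b) ≤ -t}
      ≤ F (b + -T / a) ^ (K - 1) * ∫ ω, |a * (C 0 ω - b)| ∂P := by
  have hF := nonneg_of_measureReal_le hlaw
  have hmono : Monotone F := fun x y hxy => by
    rw [← hlaw 0, ← hlaw 0]
    exact measureReal_mono fun ω (hω : C 0 ω ≤ x) => hω.trans hxy
  have hX : Integrable (fun ω => a * (C 0 ω - b)) P := (hC.sub (integrable_const b)).const_mul a
  have hint := integrableOn_measureReal_le_neg hX
  calc ∫ t in Set.Ioi T, P.real {ω | a * (maxCapacity C K ω - b) ≤ -t}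
      ≤ ∫ t in Set.Ioi T, F (b + -T / a) ^ (K - 1) * P.real {ω | a * (C 0 ω - b) ≤ -t} := by
        refine integral_mono_of_nonneg (Eventually.of_forall fun _ => measureReal_nonneg)
          ((hint.mono_set (Set.Ioi_subset_Ioi hT)).const_mul _) ?_
        refine (ae_restrict_iff' measurableSet_Ioi).mpr
          (Eventually.of_forall fun t (ht : T < t) => ?_)
        simp only [setOf_mul_sub_le_eq ha, hlaw, measureReal_maxCapacity_le hindep hlaw hK]
        rw [← Nat.sub_add_cancel hK, pow_succ, Nat.sub_add_cancel hK]
        gcongr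
        · exact hF _
        · exact hF _
        · exact hmono (by gcongr)
    _ = F (b + -T / a) ^ (K - 1) * ∫ t in Set.Ioi T, P.real {ω | a * (C 0 ω - b) ≤ -t} :=
        integral_const_mul _ _
    _ ≤ F (b + -T / a) ^ (K - 1) * ∫ ω, |a * (C 0 ω - b)| ∂P := by
        refine mul_le_mul_of_nonneg_left ?_ (pow_nonneg (hF _) _)
        exact (setIntegral_mono_set hint (Eventually.of_forall fun _ => measureReal_nonneg)
          (Set.Ioi_subset_Ioi hT).eventuallyLE).trans
            (integral_measureReal_le_neg_le_integral_abs hX)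

end Maximum

section NormalizedMaximum

theorem tendsto_mul_exp_neg_exp_div_four :
    Tendsto (fun x : ℝ => x * Real.exp (-(1 / 16 * Real.exp (x / 4)))) atTop (𝓝 0) := by
  have hexp : Tendsto (fun x : ℝ => Real.exp (x / 4)) atTop atTop :=
    Real.tendsto_exp_atTop.comp (tendsto_id.atTop_div_const four_pos)
  have hmul : Tendsto (fun y : ℝ => 4 * (y ^ (1 : ℝ) * Real.exp (-(1 / 16) * y))) atTop (𝓝 0) := by
    simpa only [mul_zero] using
      (tendsto_rpow_mul_exp_neg_mul_atTop_nhds_zero 1 (1 / 16) (by norm_num)).const_mul (4 : ℝ)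
  refine squeeze_zero' ?_ ?_ (hmul.comp hexp)
  · filter_upwards [eventually_ge_atTop 0] with x hx
    positivity
  · refine Eventually.of_forall fun x => ?_
    have hx : x ≤ 4 * Real.exp (x / 4) := by linarith [Real.add_one_le_exp (x / 4)]
    simp only [Function.comp_apply, Real.rpow_one, neg_mul, ← mul_assoc]
    gcongr

theorem isBigO_locConst {p : ℝ} (hp : 0 < p) (μ σ : ℝ) :
    locConst p μ σ =O[atTop] fun K : ℕ => √(2 * Real.log K) := by
  have hlevel : (fun s => gumbelLevel p s 0) =O[atTop] fun s => s :=
    isBigO_of_div_tendsto_nhds ((eventually_gt_atTop 0).mono fun s hs h => absurd h hs.ne') 1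
      (tendsto_gumbelLevel_div_self hp 0)
  have hconst : (fun _ : ℝ => μ) =O[atTop] fun s : ℝ => s :=
    (isLittleO_const_id_atTop μ).isBigO
  refine ((hconst.add (hlevel.const_mul_left σ)).comp_tendsto tendsto_sqrt_two_mul_log).congr' ?_
    EventuallyEq.rfl
  filter_upwards [eventually_ge_atTop 2] with K hK
  simp only [Function.comp_apply]
  rw [← locConst_add_div_scaleConst hp μ σ hK, zero_div, add_zero]

variable {Ω : Type*} {mΩ : MeasurableSpace Ω} {P : Measure Ω} [IsProbabilityMeasure P]

theorem isBigO_integral_abs_scaleConst_mul_sub {p : ℝ} (hp : 0 < p) (μ σ : ℝ) {X : Ω → ℝ}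
    (hX : Integrable X P) :
    (fun K : ℕ => ∫ ω, |scaleConst σ K * (X ω - locConst p μ σ K)| ∂P)
      =O[atTop] fun K : ℕ => Real.log K := by
  have hscale : scaleConst σ =O[atTop] fun K : ℕ => √(2 * Real.log K) :=
    ((isBigO_refl (fun K : ℕ => √(2 * Real.log K)) atTop).const_mul_left σ⁻¹).congr_left
      fun K => (div_eq_inv_mul _ _).symm
  have hmean : (fun _ : ℕ => ∫ ω, |X ω| ∂P) =O[atTop] fun K : ℕ => √(2 * Real.log K) :=
    ((isLittleO_const_id_atTop _).comp_tendsto tendsto_sqrt_two_mul_log).isBigO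
  have hprod := hscale.mul (hmean.add (isBigO_locConst hp μ σ).norm_left)
  have hlog : (fun K : ℕ => √(2 * Real.log K) * √(2 * Real.log K))
      =O[atTop] fun K : ℕ => Real.log K :=
    ((isBigO_refl (fun K : ℕ => Real.log K) atTop).const_mul_left 2).congr_left
      fun K => (sqrt_two_mul_log_natCast_sq K).symm.trans (sq _)
  refine (IsBigO.of_norm_le fun K => ?_).trans (hprod.norm_left.trans hlog)
  have hmono : ∫ ω, |X ω - locConst p μ σ K| ∂P ≤ ∫ ω, (|X ω| + |locConst p μ σ K|) ∂P :=
    integral_mono (hX.sub (integrable_const _)).abs (hX.abs.add (integrable_const _))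
      fun ω => abs_sub _ _
  rw [integral_add hX.abs (integrable_const _), integral_const, probReal_univ, one_smul] at hmono
  simp only [abs_mul, integral_const_mul, norm_mul, Real.norm_eq_abs, abs_abs]
  rw [abs_of_nonneg (integral_nonneg fun ω => abs_nonneg _)]
  exact mul_le_mul_of_nonneg_left (hmono.trans (le_abs_self _)) (abs_nonneg _)

variable {C : ℕ → Ω → ℝ} {p μ σ : ℝ} (hp : 0 < p) (hσ : 0 < σ) {F : ℝ → ℝ}
  (hF : Tendsto (fun z => (1 - F (μ + σ * z)) / gaussianTail z) atTop (𝓝 p))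
  (hindep : iIndepFun C P) (hlaw : ∀ i x, P.real {ω | C i ω ≤ x} = F x)
include hp hσ hF hindep hlaw

omit [IsProbabilityMeasure P] in
theorem tendsto_measureReal_scaleConst_mul_maxCapacity_sub_le (x : ℝ) :
    Tendsto (fun K : ℕ =>
        P.real {ω | scaleConst σ K * (maxCapacity C K ω - locConst p μ σ K) ≤ x})
      atTop (𝓝 (Real.exp (-Real.exp (-x)))) := by
  refine (tendsto_measureReal_maxCapacity_le hindep hlaw
    (tendsto_natCast_mul_one_sub hp hF x)).congr' ?_
  filter_upwards [(tendsto_scaleConst hσ).eventually_gt_atTop 0] with K ha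
  rw [setOf_mul_sub_le_eq ha]

theorem tendsto_setIntegral_measureReal_maxCapacity_le (hC : Integrable (C 0) P) :
    Tendsto (fun K : ℕ => ∫ t in Set.Ioi (Real.log K / 2),
        P.real {ω | scaleConst σ K * (maxCapacity C K ω - locConst p μ σ K) ≤ -t})
      atTop (𝓝 0) := by
  have hdecay := tendsto_mul_exp_neg_exp_div_four.comp
    (Real.tendsto_log_atTop.comp tendsto_natCast_atTop_atTop)
  refine IsBigO.trans_tendsto ?_ hdecay
  refine (IsBigO.of_norm_eventuallyLE ?_).trans
    ((isBigO_integral_abs_scaleConst_mul_sub hp μ σ hC).mul (isBigO_refl _ _))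
  filter_upwards [eventually_forall_le_natCast_mul_one_sub_neg hp hF, eventually_ge_atTop 2,
    (tendsto_scaleConst hσ).eventually_gt_atTop 0] with K hge hK ha
  have hT : 0 ≤ Real.log K / 2 := (half_pos (Real.log_pos (Nat.one_lt_cast.mpr hK))).le
  rw [Real.norm_of_nonneg (integral_nonneg fun _ => measureReal_nonneg), mul_comm]
  refine (setIntegral_measureReal_maxCapacity_le hindep hlaw hC (two_pos.trans_le hK) ha hT
    _).trans (mul_le_mul_of_nonneg_right ?_ (integral_nonneg fun _ => abs_nonneg _))
  refine (pow_le_exp_neg_mul_one_sub (nonneg_of_measureReal_le hlaw _) (K - 1)).trans ?_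
  have hcount := hge _ hT le_rfl
  have hF1 : F (locConst p μ σ K + -(Real.log K / 2) / scaleConst σ K) ≤ 1 :=
    hlaw 0 _ ▸ measureReal_le_one
  have hhalf : (K : ℝ) / 2 ≤ (K - 1 : ℕ) := by
    rw [Nat.cast_pred (two_pos.trans_le hK)]
    have : (2 : ℝ) ≤ K := Nat.ofNat_le_cast.mpr hK
    linarith
  refine Real.exp_le_exp.mpr (neg_le_neg ?_)
  calc 1 / 16 * Real.exp (Real.log K / 4)
      = 1 / 8 * Real.exp (Real.log K / 2 / 2) / 2 := by ring_nf
    _ ≤ K / 2 * (1 - F (locConst p μ σ K + -(Real.log K / 2) / scaleConst σ K)) := by linarith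
    _ ≤ (K - 1 : ℕ) * (1 - F (locConst p μ σ K + -(Real.log K / 2) / scaleConst σ K)) :=
        mul_le_mul_of_nonneg_right hhalf (sub_nonneg.mpr hF1)

theorem tendsto_integral_scaleConst_mul_maxCapacity_sub (hC : ∀ i, Integrable (C i) P) :
    Tendsto (fun K : ℕ =>
        ∫ ω, scaleConst σ K * (maxCapacity C K ω - locConst p μ σ K) ∂P)
      atTop (𝓝 Real.eulerMascheroniConstant) := by
  have hbound : IntegrableOn (fun t : ℝ => 8 * Real.exp (-(t / 2))) (Set.Ioi 0) := by
    have h := integrableOn_exp_mul_Ioi (neg_lt_zero.mpr (one_half_pos (α := ℝ))) 0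
    simpa only [IntegrableOn, neg_mul, one_div, ← div_eq_inv_mul] using h.const_mul 8
  have hX : ∀ K : ℕ,
      Integrable (fun ω => scaleConst σ K * (maxCapacity C K ω - locConst p μ σ K)) P :=
    fun K => ((integrable_maxCapacity hC K).sub (integrable_const _)).const_mul _
  rw [← gumbel_integral_tails_eq_eulerMascheroniConstant]
  refine tendsto_integral_of_tendsto_cdf hX
    (tendsto_measureReal_scaleConst_mul_maxCapacity_sub_le hp hσ hF hindep hlaw)
    ((Real.tendsto_log_atTop.comp tendsto_natCast_atTop_atTop).atTop_div_const two_pos)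
    hbound hbound ?_ ?_
    (tendsto_setIntegral_measureReal_maxCapacity_le hp hσ hF hindep hlaw (hC 0))
  · filter_upwards [eventually_forall_natCast_mul_one_sub_le hp hF, eventually_gt_atTop 0,
      (tendsto_scaleConst hσ).eventually_gt_atTop 0] with K hle hK ha t ht
    rw [setOf_mul_sub_le_eq ha]
    exact (one_sub_measureReal_maxCapacity_le_le hindep hlaw hK _).trans (hle t ht.le)
  · filter_upwards [eventually_forall_le_natCast_mul_one_sub_neg hp hF, eventually_gt_atTop 0,
      (tendsto_scaleConst hσ).eventually_gt_atTop 0] with K hge hK ha t ht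
    rw [setOf_mul_sub_le_eq ha]
    calc P.real {ω | maxCapacity C K ω ≤ locConst p μ σ K + -t / scaleConst σ K}
        ≤ Real.exp (-(1 / 8 * Real.exp (t / 2))) :=
          (measureReal_maxCapacity_le_le_exp hindep hlaw hK _).trans
            (Real.exp_le_exp.mpr (neg_le_neg (hge t ht.1.le ht.2)))
      _ ≤ (1 / 8 * Real.exp (t / 2))⁻¹ := by
          rw [Real.exp_neg]
          have := Real.add_one_le_exp (1 / 8 * Real.exp (t / 2))
          gcongr
          linarith
      _ = 8 * Real.exp (-(t / 2)) := by rw [Real.exp_neg, mul_inv, one_div, inv_inv]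

theorem isLittleO_integral_maxCapacity_sub (hC : ∀ i, Integrable (C i) P) :
    (fun K : ℕ => (∫ ω, maxCapacity C K ω ∂P)
        - (locConst p μ σ K + Real.eulerMascheroniConstant / scaleConst σ K))
      =o[atTop] fun K : ℕ => 1 / scaleConst σ K := by
  refine isLittleO_of_tendsto' ?_ ?_
  · filter_upwards [(tendsto_scaleConst hσ).eventually_gt_atTop 0] with K ha hzero
    exact absurd hzero (one_div_pos.mpr ha).ne'
  have hmean := (tendsto_integral_scaleConst_mul_maxCapacity_sub hp hσ hF hindep hlaw hC).sub_const
    Real.eulerMascheroniConstant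
  rw [sub_self] at hmean
  refine hmean.congr' ?_
  filter_upwards [(tendsto_scaleConst hσ).eventually_gt_atTop 0] with K ha
  rw [integral_const_mul, integral_sub (integrable_maxCapacity hC K) (integrable_const _),
    integral_const, probReal_univ, one_smul]
  field_simp
  ring

end NormalizedMaximum

section Capacity

variable {α β : ℝ}

theorem stationary_nonneg (hα : 0 ≤ α) (hβ : 0 ≤ β) (s : ChannelState) : 0 ≤ stationary α β s := by
  cases s
  · exact div_nonneg hβ (add_nonneg hα hβ)
  · exact div_nonneg hα (add_nonneg hα hβ)

theorem stationary_good_add_stationary_bad (hp : stationary α β .good ≠ 0) :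
    stationary α β .good + stationary α β .bad = 1 :=
  ((stationary_spec (div_ne_zero_iff.mp hp).2 _).mpr rfl).1

variable {μg μb σg σb : ℝ}

theorem one_sub_capacityCDF (hpq : stationary α β .good + stationary α β .bad = 1)
    (hσg : 0 < σg) (hσb : 0 < σb) (x : ℝ) :
    1 - capacityCDF α β μg μb σg σb x
      = stationary α β .good * gaussianTail ((x - μg) / σg)
        + stationary α β .bad * gaussianTail ((x - μb) / σb) := by
  rw [← one_sub_gaussianCDF μg hσg, ← one_sub_gaussianCDF μb hσb, capacityCDF]
  linear_combination -hpq

theorem exists_pos_eventually_add_le (hσb : 0 < σb) (hgood : σb < σg ∨ (σg = σb ∧ μb < μg)) :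
    ∃ δ > 0, ∀ᶠ z : ℝ in atTop, z + δ ≤ (μg + σg * z - μb) / σb := by
  rcases hgood with hσ | ⟨rfl, hμ⟩
  · have hgap : Tendsto (fun z => (σg - σb) / σb * z + (μg - μb) / σb) atTop atTop :=
      tendsto_atTop_add_const_right _ _
        (tendsto_id.const_mul_atTop (div_pos (sub_pos.mpr hσ) hσb))
    refine ⟨1, one_pos, ?_⟩
    filter_upwards [hgap.eventually_ge_atTop 1] with z hz
    refine (add_le_add_right hz z).trans_eq ?_
    field_simp
    ring
  · refine ⟨(μg - μb) / σg, div_pos (sub_pos.mpr hμ) hσb, Eventually.of_forall fun z => ?_⟩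
    refine le_of_eq ?_
    field_simp
    ring

theorem tendsto_one_sub_capacityCDF_div_gaussianTail
    (hpq : stationary α β .good + stationary α β .bad = 1) (hσg : 0 < σg) (hσb : 0 < σb)
    (hgood : σb < σg ∨ (σg = σb ∧ μb < μg)) :
    Tendsto (fun z => (1 - capacityCDF α β μg μb σg σb (μg + σg * z)) / gaussianTail z) atTop
      (𝓝 (stationary α β .good)) := by
  obtain ⟨δ, hδ, hgap⟩ := exists_pos_eventually_add_le hσb hgood
  have hbad := (tendsto_gaussianTail_comp_div_gaussianTail hδ hgap).const_mul
    (stationary α β .bad)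
  have hsum := hbad.const_add (stationary α β .good)
  rw [mul_zero, add_zero] at hsum
  refine hsum.congr fun z => ?_
  have := (gaussianTail_pos z).ne'
  rw [one_sub_capacityCDF hpq hσg hσb, add_sub_cancel_left, mul_div_cancel_left₀ _ hσg.ne']
  field_simp

variable {Ω : Type*} {mΩ : MeasurableSpace Ω} {P : Measure Ω} [IsFiniteMeasure P]

theorem map_eq_of_measureReal_le_eq_capacityCDF (hα : 0 ≤ α) (hβ : 0 ≤ β) {X : Ω → ℝ}
    (hX : AEMeasurable X P)
    (hlaw : ∀ x, P.real {ω | X ω ≤ x} = capacityCDF α β μg μb σg σb x) :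
    P.map X
      = ENNReal.ofReal (stationary α β .good) • gaussianReal μg (.mk (σg ^ 2) (sq_nonneg σg))
        + ENNReal.ofReal (stationary α β .bad) •
          gaussianReal μb (.mk (σb ^ 2) (sq_nonneg σb)) := by
  have hp := stationary_nonneg hα hβ .good
  have hq := stationary_nonneg hα hβ .bad
  refine Measure.ext_of_Iic _ _ fun x => ?_
  have hreal : P (X ⁻¹' Set.Iic x) = ENNReal.ofReal (P.real {ω | X ω ≤ x}) :=
    (ofReal_measureReal (measure_ne_top _ _)).symm
  rw [Measure.map_apply_of_aemeasurable hX measurableSet_Iic, Measure.add_apply,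
    Measure.smul_apply, Measure.smul_apply, smul_eq_mul, smul_eq_mul, hreal, hlaw, capacityCDF,
    gaussianCDF_eq_real, gaussianCDF_eq_real,
    ENNReal.ofReal_add (mul_nonneg hp measureReal_nonneg) (mul_nonneg hq measureReal_nonneg),
    ENNReal.ofReal_mul hp, ENNReal.ofReal_mul hq, ofReal_measureReal, ofReal_measureReal]

theorem integrable_of_measureReal_le_eq_capacityCDF (hα : 0 ≤ α) (hβ : 0 ≤ β) {X : Ω → ℝ}
    (hX : AEMeasurable X P)
    (hlaw : ∀ x, P.real {ω | X ω ≤ x} = capacityCDF α β μg μb σg σb x) : Integrable X P := by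
  have hid : ∀ m s : ℝ, Integrable id (gaussianReal m (.mk (s ^ 2) (sq_nonneg s))) :=
    fun m s => memLp_one_iff_integrable.mp (memLp_id_gaussianReal 1)
  have hmap : Integrable id (P.map X) := by
    rw [map_eq_of_measureReal_le_eq_capacityCDF hα hβ hX hlaw]
    exact ((hid μg σg).smul_measure ENNReal.ofReal_ne_top).add_measure
      ((hid μb σb).smul_measure ENNReal.ofReal_ne_top)
  exact hmap.comp_aemeasurable hX

end Capacity

end GilbertElliott

theorem mainTheorem1
    (α β : ℝ) (hα : α ∈ Set.Icc (0 : ℝ) 1) (hβ : β ∈ Set.Icc (0 : ℝ) 1)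
    (hp : GilbertElliott.stationary α β .good ≠ 0)
    (hq : GilbertElliott.stationary α β .bad ≠ 0)
    (μg μb σg σb : ℝ) (hσb : 0 < σb)
    (hgood : σb < σg ∨ (σg = σb ∧ μb < μg))
    {Ω : Type*} [MeasurableSpace Ω] (P : Measure Ω) [IsProbabilityMeasure P]
    (C : ℕ → Ω → ℝ) (hmeas : ∀ i, AEMeasurable (C i) P)
    (hindep : iIndepFun C P)
    (hlaw : ∀ i x, P.real {ω | C i ω ≤ x}
      = GilbertElliott.capacityCDF α β μg μb σg σb x) :
    (∀ x : ℝ, Tendsto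
      (fun K : ℕ => P.real {ω | GilbertElliott.scaleConst σg K *
        (GilbertElliott.maxCapacity C K ω
          - GilbertElliott.locConst (GilbertElliott.stationary α β .good) μg σg K) ≤ x})
      atTop (𝓝 (Real.exp (-Real.exp (-x))))) ∧
    (∀ K : ℕ, Integrable (GilbertElliott.maxCapacity C K) P) ∧
    (fun K : ℕ => (∫ ω, GilbertElliott.maxCapacity C K ω ∂P)
        - (GilbertElliott.locConst (GilbertElliott.stationary α β .good) μg σg K
          + Real.eulerMascheroniConstant / GilbertElliott.scaleConst σg K))
      =o[atTop] (fun K : ℕ => 1 / GilbertElliott.scaleConst σg K) := by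
  have hσg : 0 < σg := hgood.elim hσb.trans fun h => h.1 ▸ hσb
  have hp0 := (GilbertElliott.stationary_nonneg hα.1 hβ.1 .good).lt_of_ne' hp
  have htail := GilbertElliott.tendsto_one_sub_capacityCDF_div_gaussianTail
    (GilbertElliott.stationary_good_add_stationary_bad hp) hσg hσb hgood
  have hC : ∀ i, Integrable (C i) P := fun i =>
    GilbertElliott.integrable_of_measureReal_le_eq_capacityCDF hα.1 hβ.1 (hmeas i) (hlaw i)
  exact ⟨GilbertElliott.tendsto_measureReal_scaleConst_mul_maxCapacity_sub_le
      hp0 hσg htail hindep hlaw,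
    GilbertElliott.integrable_maxCapacity hC,
    GilbertElliott.isLittleO_integral_maxCapacity_sub hp0 hσg htail hindep hlaw hC⟩
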